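/- \textbf{Setting.} A line network has $L\ge 1$ links in tandem, joining nodes $v_0$ (source), $v_1,\dots,v_L$ (sink). The source holds $k$ message vectors over $\mathbb F_2$. Every link carries exactly one packet at each time instant $1,2,3,\dots$ (deterministic regular transmissions). Each packet sent over link $i$ is received without delay with probability $p_i\in(0,1]$ and is lost otherwise (Bernoulli losses), all successes being independent over links and time; received packets are kept forever. In a \emph{dense code} the source sends at each time a random linear combination of the $k$ message vectors, and each interior node sends at each time a random linear combination of all packets it received at earlier times; all coefficients are independent and uniform on $\mathbb F_2$, and independent of the losses. The global encoding vector of a packet is the vector in $\mathbb F_2^k$ of its coefficients with respect to the message vectors. The \emph{coding delay} is the least time by which the sink has received $k$ packets with linearly independent global encoding vectors ($\infty$ if there is none). It is a random variable in both the code and the losses. Below, $\log$ is the logarithm to base $2$, and $f\sim g$ means $f/g\to1$. \textbf{Theorem.} Let $L=L(k)\ge1$ be integers, $\epsilon=\epsilon(k)\in(0,1)$ and $w=w(k)$ real numbers such that, as $k\to\infty$, \[ w\sim\left(\frac{kL^2}{\log(kL/\epsilon)}\right)^{1/3}\qquad\text{and}\qquad w\log\frac{wL}{\epsilon}=o(k).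 \] Then there is a sequence $\delta(k)\to0$ such that for all sufficiently large $k$ and all $p_1,\dots,p_L\in(0,1]$, with $p=\min_{1\le i\le L}p_i$, the coding delay of a dense code with $k$ message vectors over the line network of $L$ links with deterministic regular transmissions and Bernoulli losses with parameters $p_1,\dots,p_L$ is larger than \[ \frac1p\left(k+(1+\delta(k))\left(\frac{kL}{w}+\sqrt{k\,w\log\frac{wL}{\epsilon}}+w\log\frac{wL}{\epsilon}\right)\right) \] with probability at most $\epsilon$. -/

import Mathlib

open MeasureTheory ProbabilityTheory Filter Asymptotics Topology
open scoped ENNReal unitInterval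

noncomputable section

namespace LineNetwork

/-- A realization of all the randomness of a dense code with `k` message vectors over a line network
with `L` links (link `i : Fin L`, counted from `0`, joins node `i` to node `i + 1`; node `0` is the
source, node `L` is the sink). Time slots are counted from `0`: slot `t` stands for the time instant
`t + 1`, and every link carries exactly one transmission in every slot.
* first component: `(i, t) ↦ true` iff the packet sent over link `i` in slot `t` is successful;
* second component: `(t, j) ↦` coefficient of message vector `j` in the packet that the source sends
  in slot `t`;
* third component: `(i, t, s) ↦` coefficient, in the packet that node `i` (`0 < i`) sends over link
  `i` in slot `t`, of the packet that node `i` received in slot `s`. -/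
abbrev Outcome (k L : ℕ) : Type :=
  (Fin L × ℕ → Bool) × (ℕ × Fin k → ZMod 2) × (Fin L × ℕ × ℕ → ZMod 2)

/-- The packet sent over link `i` in slot `t` is successful. It then arrives with zero delay. -/
def Outcome.Success {k L : ℕ} (ω : Outcome k L) (i : Fin L) (t : ℕ) : Prop :=
  ω.1 (i, t) = true

/-- Coefficients of the linear combination of the message vectors sent by the source in slot `t`. -/
def Outcome.sourceCoeff {k L : ℕ} (ω : Outcome k L) (t : ℕ) (j : Fin k) : ZMod 2 :=
  ω.2.1 (t, j)

/-- Local encoding coefficients of the interior nodes. -/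
def Outcome.localCoeff {k L : ℕ} (ω : Outcome k L) (i : Fin L) (t s : ℕ) : ZMod 2 :=
  ω.2.2 (i, t, s)

open scoped Classical in
/-- Global encoding vector of the packet sent over link `i` in slot `t`. The source sends a
random linear combination of the message vectors. Every interior node sends a random linear
combination of all the packets that it received in earlier slots. -/
def globalVec {k L : ℕ} (ω : Outcome k L) : (i : ℕ) → i < L → ℕ → (Fin k → ZMod 2)
  | 0, _, t => ω.sourceCoeff t
  | i + 1, h, t =>
      ∑ s ∈ (Finset.range t).filter (fun s => ω.Success ⟨i, Nat.lt_of_succ_lt h⟩ s),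
        ω.localCoeff ⟨i + 1, h⟩ t s • globalVec ω i (Nat.lt_of_succ_lt h) s

/-- By time `n` (that is, in the slots `0, …, n - 1`, at the time instants `1, …, n`) the sink has
received an innovative collection of `k` packets, i.e. `k` packets with linearly independent global
encoding vectors. -/
def SinkDecodes {k L : ℕ} (hL : 0 < L) (ω : Outcome k L) (n : ℕ) : Prop :=
  ∃ S : Finset ℕ, S.card = k ∧
    (∀ s ∈ S, s < n ∧ ω.Success ⟨L - 1, Nat.sub_one_lt_of_lt hL⟩ s) ∧
    LinearIndepOn (ZMod 2) (globalVec ω (L - 1) (Nat.sub_one_lt_of_lt hL)) (S : Set ℕ)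

/-- The coding delay: the least time at which the sink can recover all the message vectors
(`⊤` if there is no such time). -/
def codingDelay {k L : ℕ} (hL : 0 < L) (ω : Outcome k L) : ℕ∞ :=
  ⨅ (n : ℕ) (_ : SinkDecodes hL ω n), (n : ℕ∞)

/-- The law of code and traffic: packet successes over link `i` form a Bernoulli process with
parameter `p i`, all the coding coefficients are uniform on `𝔽₂`, and everything is independent. -/
def law (k : ℕ) {L : ℕ} (p : Fin L → I) : Measure (Outcome k L) :=
  (Measure.infinitePi fun x : Fin L × ℕ => bernoulliMeasure true false (p x.1)).prod
    ((Measure.infinitePi fun _ : ℕ × Fin k => uniformOn (Set.univ : Set (ZMod 2))).prod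
      (Measure.infinitePi fun _ : Fin L × ℕ × ℕ => uniformOn (Set.univ : Set (ZMod 2))))

instance law_isProbabilityMeasure (k : ℕ) {L : ℕ} (p : Fin L → I) :
    IsProbabilityMeasure (law k p) := by
  unfold law
  infer_instance

/-- The expression `k L / w + √(k w log₂(w L / ε)) + w log₂(w L / ε)`. -/
def overhead (k L w ε : ℝ) : ℝ :=
  k * L / w + √(k * (w * Real.logb 2 (w * L / ε))) + w * Real.logb 2 (w * L / ε)

end LineNetwork

end

namespace LineNetwork

/-! Let `d_i(t)` be the deficiency of node `i`. A packet sent by node `i` is uniform on the span of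
that node, so it falls into the span of node `i + 1` with conditional probability `2 ^ (-q)`, where
`q = d_{i+1} - d_i`. For `1 ≤ x ≤ 2` the factor `2 ^ (-q)` turns the weight `x ^ d_{i+1}` into at
most `x ^ d_i` (`lintegral_not_innovative_le`). Hence the means `M_i(t) = E[x ^ d_i(t)]` satisfy a
closed linear recursion, that of a tandem of servers: `M_{i+1}(t+1) ≤ M_{i+1}(t) - (1 - x⁻¹) p_i
(M_{i+1}(t) - M_i(t))`, with `M_0 = 1` (`meanWeight_step_le`).

A product `x ^ k * θ⁻¹ ^ i * λ ^ t` dominates `M_i(t) - 1` (`meanWeight_sub_one_le`), and Markov's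
inequality bounds the probability that the sink cannot decode (`law_not_sinkDecodes_le`). No
partition of time into windows occurs; `w` enters only through the size of the overhead `A`.

With `x = 1 + τ`, `θ = τ`, `τ = A / (8k)` and about `(k + A) / p` slots, the bound is `exp (1 + (L +
1) log (1/τ) - A² / (16k))` (`tail_le_exp`). The square-root term of `A` makes `A² / (16k)` at least
`w log (wL/ε) / 16`, which suffices once `w ≥ 96 L` (`overhead_exponent_le`). This last inequality
follows from the two growth hypotheses (`mul_le_of_cube_le`). -/

/-! ### Resampling coordinates of a product measure -/

open scoped Classical in
/-- The sample `ω` with the coordinates in `S` replaced by those of `r`. -/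
noncomputable def resample {ι α : Type*} (S : Set ι) (ω r : ι → α) (i : ι) : α :=
  if i ∈ S then r i else ω i

theorem resample_of_mem {ι α : Type*} {S : Set ι} (ω r : ι → α) {i : ι} (h : i ∈ S) :
    resample S ω r i = r i := if_pos h

theorem resample_of_notMem {ι α : Type*} {S : Set ι} (ω r : ι → α) {i : ι} (h : i ∉ S) :
    resample S ω r i = ω i := if_neg h

/-- Replacing the coordinates in `S` of a sample of a product measure by those of an independent
sample preserves the product measure. -/
theorem measurePreserving_resample {ι α : Type*} [MeasurableSpace α]
    (μ : ι → Measure α) [∀ i, IsProbabilityMeasure (μ i)] (S : Set ι) :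
    MeasurePreserving (fun z : (ι → α) × (ι → α) => resample S z.1 z.2)
      ((Measure.infinitePi μ).prod (Measure.infinitePi μ)) (Measure.infinitePi μ) := by
  classical
  have hm : Measurable (fun z : (ι → α) × (ι → α) => resample S z.1 z.2) := by
    refine measurable_pi_lambda _ fun i => ?_
    by_cases h : i ∈ S <;> simp only [resample, h, if_true, if_false] <;> fun_prop
  refine ⟨hm, Measure.eq_infinitePi μ fun s t ht => ?_⟩
  rw [Measure.map_apply hm (MeasurableSet.pi s.countable_toSet fun i _ => ht i)]
  have hpre : (fun z : (ι → α) × (ι → α) => resample S z.1 z.2) ⁻¹'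
      Set.pi s t = (Set.pi ((s.filter (· ∉ S) : Finset ι) : Set ι) t) ×ˢ
        (Set.pi ((s.filter (· ∈ S) : Finset ι) : Set ι) t) := by
    ext z
    simp only [Set.mem_preimage, Set.mem_pi, Set.mem_prod, Finset.coe_filter, Set.mem_ofPred_eq,
      Finset.mem_coe]
    constructor
    · intro h
      exact ⟨fun i hi => resample_of_notMem z.1 z.2 hi.2 ▸ h i hi.1,
        fun i hi => resample_of_mem z.1 z.2 hi.2 ▸ h i hi.1⟩
    · rintro ⟨h1, h2⟩ i hi
      by_cases hS : i ∈ S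
      · exact (resample_of_mem z.1 z.2 hS).symm ▸ h2 i ⟨hi, hS⟩
      · exact (resample_of_notMem z.1 z.2 hS).symm ▸ h1 i ⟨hi, hS⟩
  rw [hpre, Measure.prod_prod, Measure.infinitePi_pi μ fun i _ => ht i,
    Measure.infinitePi_pi μ fun i _ => ht i, mul_comm, Finset.prod_filter_mul_prod_filter_not]

/-- Plays the role of conditioning on the coordinates outside `S`: the inner integral averages over
fresh coordinates in `S` alone. -/
theorem lintegral_resample {ι α : Type*} [MeasurableSpace α]
    (μ : ι → Measure α) [∀ i, IsProbabilityMeasure (μ i)] (S : Set ι)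
    {F : (ι → α) → ℝ≥0∞} (hF : Measurable F) :
    ∫⁻ ω, F ω ∂Measure.infinitePi μ =
      ∫⁻ ω, ∫⁻ r, F (resample S ω r) ∂Measure.infinitePi μ ∂Measure.infinitePi μ := by
  have h := measurePreserving_resample μ S
  rw [← h.lintegral_comp hF]
  exact lintegral_prod _ (hF.comp h.measurable).aemeasurable

/-! ### Uniform vectors over the field of two elements -/

/-- Rank-nullity for `φ` and for its restriction to the preimage of `W`: both have the same kernel,
and the restriction has range `W`. -/
theorem finrank_comap_of_le_range {M N : Type*} [AddCommGroup M] [AddCommGroup N]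
    [Module (ZMod 2) M] [Module (ZMod 2) N] [FiniteDimensional (ZMod 2) M]
    [FiniteDimensional (ZMod 2) N]
    (φ : M →ₗ[ZMod 2] N) {W : Submodule (ZMod 2) N} (hW : W ≤ LinearMap.range φ) :
    Module.finrank (ZMod 2) (W.comap φ) +
        (Module.finrank (ZMod 2) (LinearMap.range φ) - Module.finrank (ZMod 2) W) =
      Module.finrank (ZMod 2) M := by
  have h1 := (φ.domRestrict (W.comap φ)).finrank_range_add_finrank_ker
  have h2 := φ.finrank_range_add_finrank_ker
  have h3 : LinearMap.range (φ.domRestrict (W.comap φ)) = W := by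
    rw [LinearMap.range_domRestrict, Submodule.map_comap_eq, inf_eq_right.2 hW]
  have h4 : Module.finrank (ZMod 2) (LinearMap.ker (φ.domRestrict (W.comap φ))) =
      Module.finrank (ZMod 2) (LinearMap.ker φ) := by
    rw [LinearMap.ker_domRestrict]
    exact (Submodule.comapSubtypeEquivOfLe (LinearMap.ker_le_comap φ)).finrank_eq
  have h5 := Submodule.finrank_mono hW
  rw [h3, h4] at h1
  omega

/-- A uniformly random vector of coefficients is mapped by `φ` into a subspace `W` of the range
of `φ` with probability `2 ^ (-codim W)`. -/
theorem infinitePi_uniform_comap {ι κ N : Type*} [Fintype κ] [AddCommGroup N]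
    [Module (ZMod 2) N] [FiniteDimensional (ZMod 2) N]
    {e : κ → ι} (he : Function.Injective e) (φ : (κ → ZMod 2) →ₗ[ZMod 2] N)
    {W : Submodule (ZMod 2) N} (hW : W ≤ LinearMap.range φ) :
    Measure.infinitePi (fun _ : ι => uniformOn (Set.univ : Set (ZMod 2)))
        {r | φ (fun j => r (e j)) ∈ W} =
      2⁻¹ ^ (Module.finrank (ZMod 2) (LinearMap.range φ) - Module.finrank (ZMod 2) W) := by
  classical
  have hpt : ∀ c : κ → ZMod 2,
      Measure.infinitePi (fun _ : ι => uniformOn (Set.univ : Set (ZMod 2)))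
        {r | (fun j => r (e j)) = c} = 2⁻¹ ^ Fintype.card κ := by
    intro c
    have hset : {r : ι → ZMod 2 | (fun j => r (e j)) = c} =
        Set.pi ((Finset.univ.image e : Finset ι) : Set ι)
          (fun i => {a | ∀ j, e j = i → a = c j}) := by
      ext r
      simp only [Set.mem_ofPred_eq, Set.mem_pi, Finset.coe_image, Finset.coe_univ, Set.image_univ,
        Set.mem_range, forall_exists_index, forall_apply_eq_imp_iff, funext_iff]
      constructor
      · intro h j j' hj
        rw [← hj, h]
      · intro h j
        exact h j j rfl
    rw [hset, Measure.infinitePi_pi _ fun i _ => .of_discrete,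
      Finset.prod_image fun a _ b _ h => he h]
    have hone : ∀ j, uniformOn (Set.univ : Set (ZMod 2)) {a | ∀ j', e j' = e j → a = c j'} =
        2⁻¹ := by
      intro j
      have : {a : ZMod 2 | ∀ j', e j' = e j → a = c j'} = {c j} := by
        ext a
        simp only [Set.mem_ofPred_eq, Set.mem_singleton_iff]
        exact ⟨fun h => h j rfl, fun h j' hj' => by rw [h, he hj']⟩
      rw [this, uniformOn_univ]
      simp [ZMod.card]
    simp [hone]
  have hm : Measurable fun r : ι → ZMod 2 => fun j => r (e j) := by fun_prop
  have hU : {r : ι → ZMod 2 | φ (fun j => r (e j)) ∈ W} =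
      ⋃ c ∈ (Finset.univ.filter fun c => c ∈ W.comap φ), {r | (fun j => r (e j)) = c} := by
    ext r
    simp
  rw [hU, measure_biUnion_finset]
  · simp only [hpt, Finset.sum_const, nsmul_eq_mul]
    -- The preimage of `W` has `2 ^ finrank` points, each of probability `2⁻¹ ^ card κ`.
    have hc : (Finset.univ.filter fun c => c ∈ W.comap φ).card =
        2 ^ Module.finrank (ZMod 2) (W.comap φ) := by
      have := Module.card_eq_pow_finrank (K := ZMod 2) (V := W.comap φ)
      rw [ZMod.card] at this
      rw [← this, Fintype.card_subtype]
    have hf := finrank_comap_of_le_range φ hW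
    rw [Module.finrank_fintype_fun_eq_card] at hf
    rw [hc, ← hf, pow_add, ← mul_assoc, Nat.cast_pow, ← mul_pow]
    simp [ENNReal.mul_inv_cancel]
  · intro c _ c' _ hcc
    refine Set.disjoint_left.2 fun r h h' => hcc ?_
    rw [Set.mem_ofPred_eq] at h h'
    exact h.symm.trans h'
  · intro c _
    exact hm (MeasurableSet.of_discrete (s := {c}))

/-! ### Node spans and deficiencies -/

section

variable {k L : ℕ}

/-- The span of the global encoding vectors of the packets that node `i` holds before slot `t`.
The source holds all the messages. -/
noncomputable def nodeSpan (ω : Outcome k L) : (i : ℕ) → i ≤ L → ℕ → Submodule (ZMod 2) (Fin k → ZMod 2)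
  | 0, _, _ => ⊤
  | i + 1, h, t =>
      Submodule.span (ZMod 2) (globalVec ω i h '' {s | s < t ∧ ω.Success ⟨i, h⟩ s})

/-- The number of dimensions that node `i` still lacks before slot `t`. -/
noncomputable def deficiency (ω : Outcome k L) (i : ℕ) (h : i ≤ L) (t : ℕ) : ℕ :=
  k - Module.finrank (ZMod 2) (nodeSpan ω i h t)

theorem finrank_nodeSpan_le (ω : Outcome k L) (i : ℕ) (h : i ≤ L) (t : ℕ) :
    Module.finrank (ZMod 2) (nodeSpan ω i h t) ≤ k := by
  simpa using Submodule.finrank_le (nodeSpan ω i h t)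

theorem nodeSpan_mono (ω : Outcome k L) (i : ℕ) (h : i ≤ L) {s t : ℕ} (hst : s ≤ t) :
    nodeSpan ω i h s ≤ nodeSpan ω i h t := by
  cases i with
  | zero => exact le_rfl
  | succ i =>
    exact Submodule.span_mono (Set.image_mono fun u hu => ⟨hu.1.trans_le hst, hu.2⟩)

theorem globalVec_mem_nodeSpan (ω : Outcome k L) (i : ℕ) (h : i < L) (t : ℕ) :
    globalVec ω i h t ∈ nodeSpan ω i h.le t := by
  classical
  cases i with
  | zero => exact Submodule.mem_top
  | succ i =>
    rw [globalVec]
    refine Submodule.sum_mem _ fun s hs => Submodule.smul_mem _ _ (Submodule.subset_span ?_)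
    rw [Finset.mem_filter, Finset.mem_range] at hs
    exact ⟨s, hs, rfl⟩

theorem nodeSpan_succ_le (ω : Outcome k L) (i : ℕ) (h : i < L) (t : ℕ) :
    nodeSpan ω (i + 1) h t ≤ nodeSpan ω i h.le t := by
  refine Submodule.span_le.2 ?_
  rintro _ ⟨s, hs, rfl⟩
  exact nodeSpan_mono ω i h.le hs.1.le (globalVec_mem_nodeSpan ω i h s)

theorem deficiency_zero (ω : Outcome k L) (t : ℕ) : deficiency ω 0 (Nat.zero_le L) t = 0 := by
  rw [deficiency, nodeSpan, finrank_top, Module.finrank_fin_fun, Nat.sub_self]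

theorem deficiency_le (ω : Outcome k L) (i : ℕ) (h : i ≤ L) (t : ℕ) : deficiency ω i h t ≤ k :=
  Nat.sub_le _ _

theorem deficiency_le_succ (ω : Outcome k L) (i : ℕ) (h : i < L) (t : ℕ) :
    deficiency ω i h.le t ≤ deficiency ω (i + 1) h t := by
  have := Submodule.finrank_mono (nodeSpan_succ_le ω i h t)
  unfold deficiency
  omega

theorem nodeSpan_step_of_not_success (ω : Outcome k L) (i : ℕ) (h : i < L) (t : ℕ)
    (hs : ¬ ω.Success ⟨i, h⟩ t) : nodeSpan ω (i + 1) h (t + 1) = nodeSpan ω (i + 1) h t := by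
  simp only [nodeSpan]
  congr 2
  ext s
  simp only [Set.mem_ofPred_eq]
  constructor
  · rintro ⟨h1, h2⟩
    refine ⟨lt_of_le_of_ne (Nat.lt_succ_iff.1 h1) ?_, h2⟩
    rintro rfl
    exact hs h2
  · exact fun ⟨h1, h2⟩ => ⟨h1.trans (Nat.lt_succ_self t), h2⟩

theorem nodeSpan_step_of_success (ω : Outcome k L) (i : ℕ) (h : i < L) (t : ℕ)
    (hs : ω.Success ⟨i, h⟩ t) :
    nodeSpan ω (i + 1) h (t + 1) =
      nodeSpan ω (i + 1) h t ⊔ Submodule.span (ZMod 2) {globalVec ω i h t} := by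
  simp only [nodeSpan]
  rw [← Submodule.span_union, ← Set.image_singleton, ← Set.image_union]
  congr 2
  ext s
  simp only [Set.mem_ofPred_eq, Set.mem_union, Set.mem_singleton_iff, Nat.lt_succ_iff_lt_or_eq]
  constructor
  · rintro ⟨h1 | h1, h2⟩
    · exact Or.inl ⟨h1, h2⟩
    · exact Or.inr h1
  · rintro (h1 | rfl)
    · exact ⟨Or.inl h1.1, h1.2⟩
    · exact ⟨Or.inr rfl, hs⟩

/-- A received packet that is not innovative, or a lost one, does not change the deficiency. -/
theorem deficiency_step_of_not (ω : Outcome k L) (i : ℕ) (h : i < L) (t : ℕ)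
    (hs : ¬ (ω.Success ⟨i, h⟩ t ∧ globalVec ω i h t ∉ nodeSpan ω (i + 1) h t)) :
    deficiency ω (i + 1) h (t + 1) = deficiency ω (i + 1) h t := by
  unfold deficiency
  by_cases h1 : ω.Success ⟨i, h⟩ t
  · have h2 : globalVec ω i h t ∈ nodeSpan ω (i + 1) h t := by
      by_contra h2
      exact hs ⟨h1, h2⟩
    rw [nodeSpan_step_of_success ω i h t h1, sup_eq_left.2]
    rwa [Submodule.span_singleton_le_iff_mem]
  · rw [nodeSpan_step_of_not_success ω i h t h1]

/-- A received innovative packet reduces the deficiency by one. -/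
theorem deficiency_step (ω : Outcome k L) (i : ℕ) (h : i < L) (t : ℕ)
    (h1 : ω.Success ⟨i, h⟩ t) (h2 : globalVec ω i h t ∉ nodeSpan ω (i + 1) h t) :
    deficiency ω (i + 1) h t = deficiency ω (i + 1) h (t + 1) + 1 := by
  have hlt : Module.finrank (ZMod 2) (nodeSpan ω (i + 1) h t) <
      Module.finrank (ZMod 2) (nodeSpan ω (i + 1) h (t + 1)) := by
    refine Submodule.finrank_lt_finrank_of_lt ?_
    rw [nodeSpan_step_of_success ω i h t h1]
    refine lt_of_le_of_ne le_sup_left fun he => h2 ?_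
    rw [he]
    exact Submodule.mem_sup_right (Submodule.mem_span_singleton_self _)
  have hle : Module.finrank (ZMod 2) (nodeSpan ω (i + 1) h (t + 1)) ≤
      Module.finrank (ZMod 2) (nodeSpan ω (i + 1) h t) + 1 := by
    rw [nodeSpan_step_of_success ω i h t h1]
    refine (Submodule.finrank_add_le_finrank_add_finrank _ _).trans ?_
    have := finrank_span_le_card (R := ZMod 2) {globalVec ω i h t}
    rw [Set.toFinset_singleton, Finset.card_singleton] at this
    omega
  have := finrank_nodeSpan_le ω (i + 1) h (t + 1)
  unfold deficiency
  omega

theorem deficiency_start (ω : Outcome k L) (i : ℕ) (h : i < L) :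
    deficiency ω (i + 1) h 0 = k := by
  have : {s | s < 0 ∧ ω.Success ⟨i, h⟩ s} = ∅ := by ext; simp
  rw [deficiency, nodeSpan, this, Set.image_empty, Submodule.span_empty, finrank_bot, Nat.sub_zero]

/-- The sink decodes as soon as the packets that it holds span everything. -/
theorem sinkDecodes_of_deficiency_eq_zero (hL : 0 < L) (ω : Outcome k L) (n : ℕ)
    (h : deficiency ω L le_rfl n = 0) : SinkDecodes hL ω n := by
  obtain ⟨l, rfl⟩ : ∃ l, L = l + 1 := ⟨L - 1, by omega⟩
  have hr : Module.finrank (ZMod 2) (nodeSpan ω (l + 1) le_rfl n) = k := by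
    have := finrank_nodeSpan_le ω (l + 1) le_rfl n
    unfold deficiency at h
    omega
  obtain ⟨b, hb, -, hsub, hli⟩ := exists_linearIndepOn_extension (K := ZMod 2)
    (v := globalVec ω l (Nat.lt_succ_self l)) (linearIndepOn_empty _ _)
    (Set.empty_subset {s | s < n ∧ ω.Success ⟨l, Nat.lt_succ_self l⟩ s})
  have hfin : b.Finite := (Set.finite_lt_nat n).subset fun s hs => (hb hs).1
  have hspan : Submodule.span (ZMod 2) (globalVec ω l (Nat.lt_succ_self l) '' b) =
      nodeSpan ω (l + 1) le_rfl n :=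
    le_antisymm (Submodule.span_mono (Set.image_mono hb)) (Submodule.span_le.2 hsub)
  refine ⟨hfin.toFinset, ?_, fun s hs => hb (hfin.mem_toFinset.1 hs), ?_⟩
  · have := hfin.fintype
    have hcard := finrank_span_eq_card hli.linearIndependent
    rw [Set.image_eq_range] at hspan
    rw [hspan, hr] at hcard
    rw [hcard, Set.Finite.card_toFinset]
  · rw [Set.Finite.coe_toFinset]
    exact hli

/-! ### Causality and measurability -/

/-- The packet of slot `t` uses coefficients of slot `t` but only successes of earlier slots, so it
is independent of the successes of slot `t`. -/
theorem globalVec_congr {ω ω' : Outcome k L} {t : ℕ}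
    (h1 : ∀ j s, s < t → ω.1 (j, s) = ω'.1 (j, s))
    (h2 : ∀ s j, s ≤ t → ω.2.1 (s, j) = ω'.2.1 (s, j))
    (h3 : ∀ j s u, s ≤ t → ω.2.2 (j, s, u) = ω'.2.2 (j, s, u)) (i : ℕ) (h : i < L) :
    globalVec ω i h t = globalVec ω' i h t := by
  classical
  induction i generalizing t with
  | zero => exact funext fun j => h2 t j le_rfl
  | succ i ih =>
    simp only [globalVec]
    refine Finset.sum_congr (Finset.filter_congr fun s hs => ?_) fun s hs => ?_
    · rw [Outcome.Success, Outcome.Success, h1 _ _ (Finset.mem_range.1 hs)]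
    · have hs' : s < t := Finset.mem_range.1 (Finset.mem_filter.1 hs).1
      rw [ih (t := s) (fun j u hu => h1 j u (hu.trans hs')) (fun u j hu => h2 u j (hu.trans hs'.le))
        (fun j u v hu => h3 j u v (hu.trans hs'.le)), Outcome.localCoeff, Outcome.localCoeff,
        h3 _ _ _ le_rfl]

/-- Here all inequalities are strict: the coefficients of slot `t` are fresh relative to the spans
before slot `t`. -/
theorem nodeSpan_congr {ω ω' : Outcome k L} {t : ℕ}
    (h1 : ∀ j s, s < t → ω.1 (j, s) = ω'.1 (j, s))
    (h2 : ∀ s j, s < t → ω.2.1 (s, j) = ω'.2.1 (s, j))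
    (h3 : ∀ j s u, s < t → ω.2.2 (j, s, u) = ω'.2.2 (j, s, u)) (i : ℕ) (h : i ≤ L) :
    nodeSpan ω i h t = nodeSpan ω' i h t := by
  cases i with
  | zero => rfl
  | succ i =>
    simp only [nodeSpan]
    have hset : {s | s < t ∧ ω.Success ⟨i, h⟩ s} = {s | s < t ∧ ω'.Success ⟨i, h⟩ s} := by
      ext s
      refine and_congr_right fun hs => ?_
      rw [Outcome.Success, Outcome.Success, h1 _ _ hs]
    rw [hset]
    congr 1
    refine Set.image_congr fun s hs => globalVec_congr (fun j u hu => h1 j u (hu.trans hs.1))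
      (fun u j hu => h2 u j (hu.trans_lt hs.1)) (fun j u v hu => h3 j u v (hu.trans_lt hs.1)) i h

instance submoduleMeasurableSpace :
    MeasurableSpace (Submodule (ZMod 2) (Fin k → ZMod 2)) := ⊤

instance submoduleDiscreteMeasurableSpace :
    DiscreteMeasurableSpace (Submodule (ZMod 2) (Fin k → ZMod 2)) := ⟨fun _ => trivial⟩

theorem measurable_globalVec (i : ℕ) (h : i < L) (t : ℕ) :
    Measurable fun ω : Outcome k L => globalVec ω i h t := by
  classical
  induction i generalizing t with
  | zero =>
    refine measurable_pi_lambda _ fun j => ?_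
    simp only [globalVec, Outcome.sourceCoeff]
    fun_prop
  | succ i ih =>
    simp only [globalVec, Finset.sum_filter]
    simp only [Outcome.Success, Outcome.localCoeff]
    refine Finset.measurable_sum _ fun s _ => Measurable.ite ?_ ?_ measurable_const
    · exact measurableSet_eq_fun (by fun_prop) measurable_const
    · have := ih (Nat.lt_of_succ_lt h) s
      exact (Measurable.of_discrete (f := fun z : ZMod 2 × (Fin k → ZMod 2) => z.1 • z.2)).comp
        (Measurable.prodMk (by fun_prop) this)

/-- The span is a function of finitely many measurable data with values in a finite discrete space.
-/
theorem measurable_nodeSpan (i : ℕ) (h : i ≤ L) (t : ℕ) :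
    Measurable fun ω : Outcome k L => nodeSpan ω i h t := by
  cases i with
  | zero => exact measurable_const
  | succ i =>
    have hsnap : Measurable fun ω : Outcome k L => fun s : Fin t =>
        (ω.1 (⟨i, h⟩, (s : ℕ)), globalVec ω i h s) := by
      refine measurable_pi_lambda _ fun s => Measurable.prodMk (by fun_prop) ?_
      exact measurable_globalVec i h s
    convert! (Measurable.of_discrete (f := fun z : Fin t → Bool × (Fin k → ZMod 2) =>
      Submodule.span (ZMod 2) ((fun s => (z s).2) '' {s | (z s).1 = true}))).comp hsnap using 2
    simp only [nodeSpan, Function.comp]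
    congr 1
    ext v
    constructor
    · rintro ⟨s, hs, rfl⟩
      exact ⟨⟨s, hs.1⟩, hs.2, rfl⟩
    · rintro ⟨s, hs, rfl⟩
      exact ⟨s, ⟨s.2, hs⟩, rfl⟩

theorem measurable_deficiency (i : ℕ) (h : i ≤ L) (t : ℕ) :
    Measurable fun ω : Outcome k L => deficiency ω i h t :=
  (Measurable.of_discrete (f := fun V : Submodule (ZMod 2) (Fin k → ZMod 2) =>
    k - Module.finrank (ZMod 2) V)).comp (measurable_nodeSpan i h t)

theorem measurableSet_innovative (i : ℕ) (h : i < L) (t : ℕ) :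
    MeasurableSet {ω : Outcome k L | globalVec ω i h t ∉ nodeSpan ω (i + 1) h t} :=
  ((measurable_globalVec i h t).prodMk (measurable_nodeSpan (i + 1) h t))
    (MeasurableSet.of_discrete
      (s := {z : (Fin k → ZMod 2) × Submodule (ZMod 2) (Fin k → ZMod 2) | z.1 ∉ z.2}))

/-! ### Integrating out the fresh randomness of a slot -/

/-- The success of the packet sent over a link in a slot is independent of whatever does not depend
on this success. -/
theorem lintegral_law_success_mul (p : Fin L → I) (i : Fin L) (t : ℕ)
    {G : Outcome k L → ℝ≥0∞} (hG : Measurable G)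
    (hdep : ∀ a a' z, (∀ j, j ≠ (i, t) → a j = a' j) → G (a, z) = G (a', z)) :
    ∫⁻ ω, ({ω : Outcome k L | ω.Success i t}.indicator 1 ω) * G ω ∂law k p =
      ENNReal.ofReal (p i) * ∫⁻ ω, G ω ∂law k p := by
  classical
  have hS : MeasurableSet {ω : Outcome k L | ω.Success i t} :=
    measurableSet_eq_fun (f := fun ω : Outcome k L => ω.1 (i, t)) (by fun_prop) measurable_const
  have hF : Measurable fun ω : Outcome k L =>
      ({ω : Outcome k L | ω.Success i t}.indicator 1 ω) * G ω :=
    (measurable_one.indicator hS).mul hG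
  unfold law
  rw [lintegral_prod_symm' _ hF, lintegral_prod_symm' _ hG, ← lintegral_const_mul]
  swap
  · exact hG.lintegral_prod_left'
  refine lintegral_congr fun z => ?_
  have hFz : Measurable fun a => ({ω : Outcome k L | ω.Success i t}.indicator 1 (a, z)) * G (a, z) :=
    hF.comp measurable_prodMk_right
  rw [lintegral_resample _ {(i, t)} hFz, ← lintegral_const_mul]
  swap
  · exact hG.comp measurable_prodMk_right
  refine lintegral_congr fun a => ?_
  refine (lintegral_congr (g := fun r =>
    ((Function.eval (i, t) ⁻¹' {true} : Set (Fin L × ℕ → Bool)).indicator 1 r) * G (a, z))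
      fun r => ?_).trans ?_
  · congr 1
    · simp [Set.indicator, Outcome.Success, resample]
    · exact hdep _ _ _ fun j hj => resample_of_notMem a r hj
  have hT : MeasurableSet (Function.eval (i, t) ⁻¹' {true} : Set (Fin L × ℕ → Bool)) :=
    (measurable_pi_apply _) (MeasurableSet.of_discrete)
  rw [lintegral_mul_const _ (measurable_one.indicator hT), lintegral_indicator_one hT,
    (measurePreserving_eval_infinitePi
      (fun x : Fin L × ℕ => bernoulliMeasure true false (p x.1)) (i, t)).measure_preimage
      MeasurableSet.of_discrete.nullMeasurableSet,
    bernoulliMeasure_apply_of_mem_of_notMem (s := {true}) _ .of_discrete (Set.mem_singleton _)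
      (fun hf => Bool.false_ne_true hf)]
  congr 1
  rw [ENNReal.ofReal, ENNReal.coe_inj]
  ext
  simp [(p i).2.1]

/-- By Fubini, an inequality between means follows from the one between conditional means given
everything but the source coefficients in `S`. -/
theorem lintegral_law_le_of_source (p : Fin L → I) (S : Set (ℕ × Fin k))
    {H K : Outcome k L → ℝ≥0∞} (hH : Measurable H) (hK : Measurable K)
    (h : ∀ ω : Outcome k L, ∫⁻ r, H (ω.1, resample S ω.2.1 r, ω.2.2)
      ∂Measure.infinitePi (fun _ : ℕ × Fin k => uniformOn (Set.univ : Set (ZMod 2))) ≤ K ω) :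
    ∫⁻ ω, H ω ∂law k p ≤ ∫⁻ ω, K ω ∂law k p := by
  unfold law
  rw [lintegral_prod _ hH.aemeasurable, lintegral_prod _ hK.aemeasurable]
  refine lintegral_mono fun a => ?_
  have hHa : Measurable fun z => H (a, z) := hH.comp measurable_prodMk_left
  have hKa : Measurable fun z => K (a, z) := hK.comp measurable_prodMk_left
  rw [lintegral_prod_symm' _ hHa, lintegral_prod_symm' _ hKa]
  refine lintegral_mono fun c => ?_
  have hHc : Measurable fun b => H (a, b, c) := hHa.comp measurable_prodMk_right
  dsimp only
  rw [lintegral_resample _ S hHc]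
  exact lintegral_mono fun b => h (a, b, c)

theorem lintegral_law_le_of_local (p : Fin L → I) (S : Set (Fin L × ℕ × ℕ))
    {H K : Outcome k L → ℝ≥0∞} (hH : Measurable H) (hK : Measurable K)
    (h : ∀ ω : Outcome k L, ∫⁻ r, H (ω.1, ω.2.1, resample S ω.2.2 r)
      ∂Measure.infinitePi (fun _ : Fin L × ℕ × ℕ => uniformOn (Set.univ : Set (ZMod 2))) ≤ K ω) :
    ∫⁻ ω, H ω ∂law k p ≤ ∫⁻ ω, K ω ∂law k p := by
  unfold law
  rw [lintegral_prod _ hH.aemeasurable, lintegral_prod _ hK.aemeasurable]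
  refine lintegral_mono fun a => ?_
  have hHa : Measurable fun z => H (a, z) := hH.comp measurable_prodMk_left
  have hKa : Measurable fun z => K (a, z) := hK.comp measurable_prodMk_left
  rw [lintegral_prod _ hHa.aemeasurable, lintegral_prod _ hKa.aemeasurable]
  refine lintegral_mono fun b => ?_
  have hHb : Measurable fun c => H (a, b, c) := hHa.comp measurable_prodMk_left
  dsimp only
  rw [lintegral_resample _ S hHb]
  exact lintegral_mono fun c => h (a, b, c)

/-! ### Exponential weights -/

/-- The exponential weight of the deficiency of a node. -/
noncomputable def weight (x : ℝ) (ω : Outcome k L) (i : ℕ) (h : i ≤ L) (t : ℕ) : ℝ≥0∞ :=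
  ENNReal.ofReal (x ^ deficiency ω i h t)

theorem weight_congr {x : ℝ} {ω ω' : Outcome k L} {i : ℕ} {h : i ≤ L} {t : ℕ}
    (hV : nodeSpan ω i h t = nodeSpan ω' i h t) : weight x ω i h t = weight x ω' i h t := by
  unfold weight deficiency
  rw [hV]

theorem indicator_one_congr {α β : Type*} {S : Set α} {T : Set β} {a : α} {b : β}
    (h : a ∈ S ↔ b ∈ T) : S.indicator (1 : α → ℝ≥0∞) a = T.indicator 1 b := by
  classical
  rw [Set.indicator_apply, Set.indicator_apply]
  simp only [h, Pi.one_apply]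

theorem measurable_weight (x : ℝ) (i : ℕ) (h : i ≤ L) (t : ℕ) :
    Measurable fun ω : Outcome k L => weight x ω i h t :=
  (Measurable.of_discrete (f := fun d : ℕ => ENNReal.ofReal (x ^ d))).comp
    (measurable_deficiency i h t)

/-- The quotient of the two sides is `(x / 2) ^ q ≤ 1`; this is where `x ≤ 2` is needed. -/
theorem pow_sub_finrank_mul_weight_le {x : ℝ} (hx : 1 ≤ x) (hx2 : x ≤ 2) (ω : Outcome k L)
    (i : ℕ) (h : i < L) (t : ℕ) :
    (2⁻¹ : ℝ≥0∞) ^ (Module.finrank (ZMod 2) (nodeSpan ω i h.le t) -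
        Module.finrank (ZMod 2) (nodeSpan ω (i + 1) h t)) * weight x ω (i + 1) h t ≤
      weight x ω i h.le t := by
  have h1 := Submodule.finrank_mono (nodeSpan_succ_le ω i h t)
  have h2 := finrank_nodeSpan_le ω i h.le t
  set q := Module.finrank (ZMod 2) (nodeSpan ω i h.le t) -
    Module.finrank (ZMod 2) (nodeSpan ω (i + 1) h t) with hq
  have hd : deficiency ω (i + 1) h t = q + deficiency ω i h.le t := by
    unfold deficiency
    omega
  have hhalf : (2⁻¹ : ℝ≥0∞) = ENNReal.ofReal (2⁻¹) := by
    rw [ENNReal.ofReal_inv_of_pos two_pos]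
    simp
  unfold weight
  rw [hd, hhalf, ← ENNReal.ofReal_pow (by norm_num), ← ENNReal.ofReal_mul (by positivity)]
  refine ENNReal.ofReal_le_ofReal ?_
  rw [pow_add, ← mul_assoc, ← mul_pow]
  have : (2⁻¹ * x) ^ q ≤ 1 := pow_le_one₀ (by positivity) (by linarith)
  have hpos : 0 ≤ x ^ deficiency ω i h.le t := by positivity
  nlinarith

theorem lintegral_indicator_infinitePi_comap {ι κ N : Type*} [Fintype κ] [AddCommGroup N]
    [Module (ZMod 2) N] [FiniteDimensional (ZMod 2) N]
    {e : κ → ι} (he : Function.Injective e) (φ : (κ → ZMod 2) →ₗ[ZMod 2] N)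
    {W : Submodule (ZMod 2) N} (hW : W ≤ LinearMap.range φ) (c : ℝ≥0∞) :
    ∫⁻ r, ({r | φ (fun j => r (e j)) ∈ W}.indicator 1 r) * c
      ∂Measure.infinitePi (fun _ : ι => uniformOn (Set.univ : Set (ZMod 2))) =
      2⁻¹ ^ (Module.finrank (ZMod 2) (LinearMap.range φ) - Module.finrank (ZMod 2) W) * c := by
  have hm : Measurable fun r : ι → ZMod 2 => fun j => r (e j) := by fun_prop
  have hset : MeasurableSet {r : ι → ZMod 2 | φ (fun j => r (e j)) ∈ W} :=
    hm (MeasurableSet.of_discrete (s := {c | φ c ∈ W}))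
  rw [lintegral_mul_const _ (measurable_one.indicator hset), lintegral_indicator_one hset,
    infinitePi_uniform_comap he φ hW]

theorem measurableSet_not_innovative (i : ℕ) (h : i < L) (t : ℕ) :
    MeasurableSet {ω : Outcome k L | globalVec ω i h t ∈ nodeSpan ω (i + 1) h t} := by
  simpa [Set.compl_def] using (measurableSet_innovative (k := k) i h t).compl

theorem measurable_not_innovative_mul_weight (x : ℝ) (i : ℕ) (h : i < L) (t : ℕ) :
    Measurable fun ω : Outcome k L =>
      ({ω : Outcome k L | globalVec ω i h t ∈ nodeSpan ω (i + 1) h t}.indicator 1 ω) *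
        weight x ω (i + 1) h t :=
  (measurable_one.indicator (measurableSet_not_innovative i h t)).mul
    (measurable_weight x (i + 1) h t)

/-- Resampling the source coefficients of slot `t` leaves the span of node `1` unchanged and makes
the sent vector uniform on the whole space. -/
theorem lintegral_source_not_innovative_le (p : Fin L → I) {x : ℝ} (hx : 1 ≤ x) (hx2 : x ≤ 2)
    (h : 0 < L) (t : ℕ) :
    ∫⁻ ω : Outcome k L, ({ω : Outcome k L | globalVec ω 0 h t ∈ nodeSpan ω 1 h t}.indicator
        1 ω) * weight x ω 1 h t ∂law k p ≤ ∫⁻ ω, weight x ω 0 h.le t ∂law k p := by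
  refine lintegral_law_le_of_source p {z | z.1 = t}
    (measurable_not_innovative_mul_weight x 0 h t) (measurable_weight x 0 h.le t) fun ω => ?_
  refine le_trans (le_of_eq ?_) (pow_sub_finrank_mul_weight_le hx hx2 ω 0 h t)
  have he : Function.Injective fun j : Fin k => (t, j) := fun a b hab => (Prod.ext_iff.1 hab).2
  have key := lintegral_indicator_infinitePi_comap he
    (LinearMap.id : (Fin k → ZMod 2) →ₗ[ZMod 2] _) (W := nodeSpan ω 1 h t)
    (by simp) (weight x ω 1 h t)
  rw [LinearMap.range_id] at key
  refine Eq.trans (lintegral_congr fun r => ?_) key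
  set ω' : Outcome k L := (ω.1, resample {z | z.1 = t} ω.2.1 r, ω.2.2)
  have hV : nodeSpan ω' 1 h t = nodeSpan ω 1 h t :=
    nodeSpan_congr (ω := ω') (ω' := ω) (fun _ _ _ => rfl)
      (fun s j hs => resample_of_notMem _ _ hs.ne)
      (fun _ _ _ _ => rfl) 1 h
  have hX : globalVec ω' 0 h t = fun j => r (t, j) :=
    funext fun j => resample_of_mem _ _ rfl
  rw [weight_congr hV, indicator_one_congr]
  change globalVec ω' 0 h t ∈ nodeSpan ω' 1 h t ↔ _
  rw [hV, hX]
  rfl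

theorem lintegral_interior_not_innovative_le (p : Fin L → I) {x : ℝ} (hx : 1 ≤ x) (hx2 : x ≤ 2)
    (i : ℕ) (h : i + 1 < L) (t : ℕ) :
    ∫⁻ ω : Outcome k L,
        ({ω : Outcome k L | globalVec ω (i + 1) h t ∈ nodeSpan ω (i + 1 + 1) h t}.indicator 1 ω) *
          weight x ω (i + 1 + 1) h t ∂law k p ≤
      ∫⁻ ω, weight x ω (i + 1) h.le t ∂law k p := by
  classical
  refine lintegral_law_le_of_local p {z | z.2.1 = t}
    (measurable_not_innovative_mul_weight x (i + 1) h t) (measurable_weight x (i + 1) h.le t)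
    fun ω => ?_
  refine le_trans (le_of_eq ?_) (pow_sub_finrank_mul_weight_le hx hx2 ω (i + 1) h t)
  -- `κ` indexes the packets held by the node, and `φ` maps fresh coefficients to the packet sent.
  -- Its range is the span of the node.
  let κ := {s : Fin t // ω.Success ⟨i, Nat.lt_of_succ_lt h⟩ s}
  let φ : (κ → ZMod 2) →ₗ[ZMod 2] (Fin k → ZMod 2) :=
    Fintype.linearCombination (ZMod 2) fun s : κ => globalVec ω i (Nat.lt_of_succ_lt h) s.1
  have hrange : LinearMap.range φ = nodeSpan ω (i + 1) h.le t := by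
    rw [Fintype.range_linearCombination, nodeSpan]
    congr 1
    ext v
    constructor
    · rintro ⟨s, rfl⟩
      exact ⟨s.1, ⟨s.1.2, s.2⟩, rfl⟩
    · rintro ⟨s, hs, rfl⟩
      exact ⟨⟨⟨s, hs.1⟩, hs.2⟩, rfl⟩
  have he : Function.Injective fun s : κ => ((⟨i + 1, h⟩ : Fin L), t, ((s.1 : Fin t) : ℕ)) := by
    intro a b hab
    simp only [Prod.mk.injEq, true_and] at hab
    exact Subtype.ext (Fin.ext hab)
  have key := lintegral_indicator_infinitePi_comap he φ (W := nodeSpan ω (i + 1 + 1) h t)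
    (hrange ▸ nodeSpan_succ_le ω (i + 1) h t) (weight x ω (i + 1 + 1) h t)
  rw [hrange] at key
  refine Eq.trans (lintegral_congr fun r => ?_) key
  set ω' : Outcome k L := (ω.1, ω.2.1, resample {z | z.2.1 = t} ω.2.2 r) with hω'
  have hV : nodeSpan ω' (i + 1 + 1) h t = nodeSpan ω (i + 1 + 1) h t :=
    nodeSpan_congr (ω := ω') (ω' := ω) (fun _ _ _ => rfl) (fun _ _ _ => rfl)
      (fun _ s _ hs => resample_of_notMem _ _ hs.ne) _ h
  have hX : globalVec ω' (i + 1) h t =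
      φ (fun s => r ((⟨i + 1, h⟩ : Fin L), t, ((s.1 : Fin t) : ℕ))) := by
    rw [globalVec, Finset.sum_filter, Finset.sum_range, ← Finset.sum_filter]
    simp only [φ, Fintype.linearCombination_apply]
    rw [Finset.sum_subtype (p := fun s : Fin t => ω.Success ⟨i, Nat.lt_of_succ_lt h⟩ s) _
      (fun s => by simp [hω', Outcome.Success])]
    refine Finset.sum_congr rfl fun s _ => ?_
    congr 1
    · exact resample_of_mem _ _ rfl
    · exact globalVec_congr (ω := ω') (ω' := ω) (fun _ _ _ => rfl) (fun _ _ _ => rfl)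
        (fun _ u _ hu => resample_of_notMem _ _ (hu.trans_lt s.1.2).ne) i _
  rw [weight_congr hV, indicator_one_congr]
  change globalVec ω' (i + 1) h t ∈ nodeSpan ω' (i + 1 + 1) h t ↔ _
  rw [hV, hX]
  rfl

/-- The packet sent by node `i` lies in the span of the next node with conditional probability
`2 ^ (-q)`, where `q` is the difference of the dimensions of the two spans. -/
theorem lintegral_not_innovative_le (p : Fin L → I) {x : ℝ} (hx : 1 ≤ x) (hx2 : x ≤ 2)
    (i : ℕ) (h : i < L) (t : ℕ) :
    ∫⁻ ω : Outcome k L, ({ω : Outcome k L | globalVec ω i h t ∈ nodeSpan ω (i + 1) h t}.indicator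
        1 ω) * weight x ω (i + 1) h t ∂law k p ≤ ∫⁻ ω, weight x ω i h.le t ∂law k p := by
  cases i with
  | zero => exact lintegral_source_not_innovative_le p hx hx2 h t
  | succ i => exact lintegral_interior_not_innovative_le p hx hx2 i h t

/-- An innovative reception divides the weight by `x`. The loss is written on the left as a summand,
which avoids truncated subtraction in `ℝ≥0∞`. -/
theorem weight_step {x : ℝ} (hx : 1 ≤ x) (ω : Outcome k L) (i : ℕ) (h : i < L) (t : ℕ) :
    weight x ω (i + 1) h (t + 1) + ENNReal.ofReal (1 - x⁻¹) *
      (({ω : Outcome k L | ω.Success ⟨i, h⟩ t}.indicator 1 ω) *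
        (({ω : Outcome k L | globalVec ω i h t ∉ nodeSpan ω (i + 1) h t}.indicator 1 ω) *
          weight x ω (i + 1) h t)) = weight x ω (i + 1) h t := by
  by_cases hs : ω.Success ⟨i, h⟩ t ∧ globalVec ω i h t ∉ nodeSpan ω (i + 1) h t
  · have hx0 : x ≠ 0 := by positivity
    have hinv : 0 ≤ 1 - x⁻¹ := sub_nonneg.2 (inv_le_one_of_one_le₀ hx)
    simp only [Set.indicator, Set.mem_ofPred_eq, hs.1, hs.2, not_false_eq_true, if_true,
      Pi.one_apply, one_mul, weight, deficiency_step ω i h t hs.1 hs.2]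
    rw [← ENNReal.ofReal_mul hinv, ← ENNReal.ofReal_add (by positivity) (by positivity)]
    congr 1
    field_simp
    ring
  · rw [weight, deficiency_step_of_not ω i h t hs]
    by_cases h1 : ω.Success ⟨i, h⟩ t
    · have h2 : globalVec ω i h t ∈ nodeSpan ω (i + 1) h t := by
        by_contra h2
        exact hs ⟨h1, h2⟩
      simp [Set.indicator, h2, weight]
    · simp [Set.indicator, h1, weight]

/-! ### The recursion for the mean weights and its solution -/

/-- The expected exponential weight of the deficiency of a node. -/
noncomputable def meanWeight (p : Fin L → I) (k : ℕ) (x : ℝ) (i : ℕ) (h : i ≤ L) (t : ℕ) : ℝ :=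
  (∫⁻ ω, weight x ω i h t ∂law k p).toReal

theorem lintegral_weight_ne_top (p : Fin L → I) {x : ℝ} (hx : 1 ≤ x) (i : ℕ) (h : i ≤ L) (t : ℕ) :
    ∫⁻ ω, weight x ω i h t ∂law k p ≠ ∞ := by
  refine ne_top_of_le_ne_top (b := ENNReal.ofReal (x ^ k)) ENNReal.ofReal_ne_top ?_
  calc ∫⁻ ω, weight x ω i h t ∂law k p ≤ ∫⁻ _, ENNReal.ofReal (x ^ k) ∂law k p :=
        lintegral_mono fun ω =>
          ENNReal.ofReal_le_ofReal (pow_le_pow_right₀ hx (deficiency_le ω i h t))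
    _ = ENNReal.ofReal (x ^ k) := by simp

theorem meanWeight_zero (p : Fin L → I) (x : ℝ) (t : ℕ) :
    meanWeight p k x 0 (Nat.zero_le L) t = 1 := by
  simp [meanWeight, weight, deficiency_zero]

theorem meanWeight_start (p : Fin L → I) {x : ℝ} (hx : 1 ≤ x) (i : ℕ) (h : i < L) :
    meanWeight p k x (i + 1) h 0 = x ^ k := by
  have : 0 ≤ x ^ k := by positivity
  simp [meanWeight, weight, deficiency_start, this]

/-- Makes the bracket in `meanWeight_step_le` nonnegative, so that each `p i` may be replaced there
by a common lower bound `q`. -/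
theorem meanWeight_le_succ (p : Fin L → I) {x : ℝ} (hx : 1 ≤ x) (i : ℕ) (h : i < L) (t : ℕ) :
    meanWeight p k x i h.le t ≤ meanWeight p k x (i + 1) h t :=
  ENNReal.toReal_mono (lintegral_weight_ne_top p hx _ _ _) <| lintegral_mono fun ω =>
    ENNReal.ofReal_le_ofReal (pow_le_pow_right₀ hx (deficiency_le_succ ω i h t))

/-- One slot decreases the mean weight of a node at least as in a tandem of geometric servers. -/
theorem meanWeight_step_le (p : Fin L → I) {x : ℝ} (hx : 1 ≤ x) (hx2 : x ≤ 2)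
    (i : ℕ) (h : i < L) (t : ℕ) :
    meanWeight p k x (i + 1) h (t + 1) ≤ meanWeight p k x (i + 1) h t -
      (1 - x⁻¹) * p ⟨i, h⟩ * (meanWeight p k x (i + 1) h t - meanWeight p k x i h.le t) := by
  have hsetI := measurableSet_innovative (k := k) i h t
  have hsetS : MeasurableSet {ω : Outcome k L | ω.Success ⟨i, h⟩ t} :=
    measurableSet_eq_fun (f := fun ω : Outcome k L => ω.1 (⟨i, h⟩, t)) (by fun_prop)
      measurable_const
  have hw := measurable_weight (k := k) x (i + 1) h t
  have hw' := measurable_weight (k := k) x (i + 1) h (t + 1)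
  have hG : Measurable fun ω : Outcome k L =>
      ({ω : Outcome k L | globalVec ω i h t ∉ nodeSpan ω (i + 1) h t}.indicator
        (1 : Outcome k L → ℝ≥0∞) ω) * weight x ω (i + 1) h t :=
    (measurable_one.indicator hsetI).mul hw
  have hSG : Measurable fun ω : Outcome k L =>
      ({ω : Outcome k L | ω.Success ⟨i, h⟩ t}.indicator (1 : Outcome k L → ℝ≥0∞) ω) *
        (({ω : Outcome k L | globalVec ω i h t ∉ nodeSpan ω (i + 1) h t}.indicator
          (1 : Outcome k L → ℝ≥0∞) ω) * weight x ω (i + 1) h t) :=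
    (measurable_one.indicator hsetS).mul hG
  have hinv : 0 ≤ 1 - x⁻¹ := sub_nonneg.2 (inv_le_one_of_one_le₀ hx)
  have e1 := lintegral_congr (μ := law k p) fun ω : Outcome k L => weight_step hx ω i h t
  rw [lintegral_add_left hw', lintegral_const_mul _ hSG,
    lintegral_law_success_mul p ⟨i, h⟩ t hG] at e1
  swap
  · intro a a' z haa
    have hne : ∀ j : Fin L, ∀ s, s < t → a (j, s) = a' (j, s) := fun j s hs =>
      haa _ fun he => hs.ne (Prod.ext_iff.1 he).2
    have hX : globalVec (k := k) (a, z) i h t = globalVec (a', z) i h t :=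
      globalVec_congr (ω := (a, z)) (ω' := (a', z)) hne (fun _ _ _ => rfl) (fun _ _ _ _ => rfl) i h
    have hV : nodeSpan (k := k) (a, z) (i + 1) h t = nodeSpan (a', z) (i + 1) h t :=
      nodeSpan_congr (ω := (a, z)) (ω' := (a', z)) hne (fun _ _ _ => rfl) (fun _ _ _ _ => rfl) (i + 1) h
    rw [weight_congr hV, indicator_one_congr]
    change globalVec (k := k) (a, z) i h t ∉ nodeSpan (a, z) (i + 1) h t ↔
      globalVec (k := k) (a', z) i h t ∉ nodeSpan (a', z) (i + 1) h t
    rw [hV, hX]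
  -- The innovative part, needed from below, is the total minus the non-innovative part, which `e3`
  -- bounds by the mean weight of node `i`.
  have e2 : ∫⁻ ω : Outcome k L,
      ({ω : Outcome k L | globalVec ω i h t ∉ nodeSpan ω (i + 1) h t}.indicator 1 ω) *
        weight x ω (i + 1) h t ∂law k p +
      ∫⁻ ω : Outcome k L,
        ({ω : Outcome k L | globalVec ω i h t ∈ nodeSpan ω (i + 1) h t}.indicator 1 ω) *
        weight x ω (i + 1) h t ∂law k p = ∫⁻ ω, weight x ω (i + 1) h t ∂law k p := by
    rw [← lintegral_add_left hG]
    refine lintegral_congr fun ω => ?_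
    by_cases hm : globalVec ω i h t ∈ nodeSpan ω (i + 1) h t <;> simp [Set.indicator, hm]
  have e3 := lintegral_not_innovative_le (k := k) p hx hx2 i h t
  have hA := lintegral_weight_ne_top (k := k) p hx (i + 1) h t
  have hA' := lintegral_weight_ne_top (k := k) p hx (i + 1) h (t + 1)
  have hB := lintegral_weight_ne_top (k := k) p hx i h.le t
  unfold meanWeight
  generalize ∫⁻ ω, weight x ω (i + 1) h t ∂law k p = A at *
  generalize ∫⁻ ω, weight x ω (i + 1) h (t + 1) ∂law k p = A' at *
  generalize ∫⁻ ω, weight x ω i h.le t ∂law k p = B at *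
  generalize ∫⁻ ω : Outcome k L,
      ({ω : Outcome k L | globalVec ω i h t ∉ nodeSpan ω (i + 1) h t}.indicator 1 ω) *
        weight x ω (i + 1) h t ∂law k p = U at *
  generalize ∫⁻ ω : Outcome k L,
      ({ω : Outcome k L | globalVec ω i h t ∈ nodeSpan ω (i + 1) h t}.indicator 1 ω) *
        weight x ω (i + 1) h t ∂law k p = V at *
  have hU : U ≠ ∞ := ne_top_of_le_ne_top hA (e2 ▸ le_self_add)
  have hV : V ≠ ∞ := ne_top_of_le_ne_top hB e3
  have hp : (0 : ℝ) ≤ p ⟨i, h⟩ := (p ⟨i, h⟩).2.1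
  have r1 := congrArg ENNReal.toReal e1
  have r2 := congrArg ENNReal.toReal e2
  have r3 := ENNReal.toReal_mono hB e3
  rw [ENNReal.toReal_add hA' (by finiteness), ENNReal.toReal_mul, ENNReal.toReal_mul,
    ENNReal.toReal_ofReal hinv, ENNReal.toReal_ofReal hp] at r1
  rw [ENNReal.toReal_add hU hV] at r2
  have := mul_nonneg hinv hp
  nlinarith

/-- Subtracting the fixed point `1` makes the recursion homogeneous with zero boundary value at the
source. The right side is a supersolution: with `c = q (1 - x⁻¹)`, its values at `i + 1` and `i`,
weighted by `1 - c` and `c`, add up to the factor `1 - c (1 - θ)`. -/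
theorem meanWeight_sub_one_le (p : Fin L → I) {x θ q : ℝ} (hx : 1 ≤ x) (hx2 : x ≤ 2)
    (hθ : 0 < θ) (hθ1 : θ ≤ 1) (hq : 0 ≤ q) (hq1 : q ≤ 1) (hqp : ∀ i, q ≤ p i)
    (t : ℕ) (i : ℕ) (h : i ≤ L) :
    meanWeight p k x i h t - 1 ≤
      x ^ k * (θ⁻¹) ^ i * (1 - q * (1 - x⁻¹) * (1 - θ)) ^ t := by
  have hinv : 0 ≤ 1 - x⁻¹ := sub_nonneg.2 (inv_le_one_of_one_le₀ hx)
  have hinv1 : 1 - x⁻¹ ≤ 1 := by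
    have : 0 < x⁻¹ := by positivity
    linarith
  have hc0 : 0 ≤ q * (1 - x⁻¹) := mul_nonneg hq hinv
  have hc1 : q * (1 - x⁻¹) ≤ 1 := mul_le_one₀ hq1 hinv hinv1
  have hlam : 0 ≤ 1 - q * (1 - x⁻¹) * (1 - θ) := by nlinarith
  induction t generalizing i with
  | zero =>
    cases i with
    | zero =>
      rw [meanWeight_zero]
      simp only [sub_self, pow_zero, mul_one]
      positivity
    | succ i =>
      rw [meanWeight_start p hx, pow_zero, mul_one]
      have h1 : 1 ≤ (θ⁻¹) ^ (i + 1) := one_le_pow₀ ((one_le_inv₀ hθ).2 hθ1)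
      have h2 : 0 ≤ x ^ k := by positivity
      nlinarith
  | succ t ih =>
    cases i with
    | zero =>
      rw [meanWeight_zero]
      rw [sub_self]
      positivity
    | succ i =>
      have h1 := meanWeight_step_le (k := k) p hx hx2 i h t
      have h2 := meanWeight_le_succ (k := k) p hx i h t
      have h3 := ih (i + 1) h
      have h4 := ih i (Nat.le_of_succ_le h)
      have h5 : q * (1 - x⁻¹) *
            (meanWeight p k x (i + 1) h t - meanWeight p k x i (Nat.le_of_succ_le h) t) ≤
          (1 - x⁻¹) * p ⟨i, h⟩ *
            (meanWeight p k x (i + 1) h t - meanWeight p k x i (Nat.le_of_succ_le h) t) := by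
        refine mul_le_mul_of_nonneg_right ?_ (sub_nonneg.2 h2)
        rw [mul_comm]
        exact mul_le_mul_of_nonneg_left (hqp _) hinv
      have e : θ⁻¹ ^ i = θ * θ⁻¹ ^ (i + 1) := by
        rw [pow_succ]
        field_simp
      rw [e] at h4
      rw [pow_succ (1 - q * (1 - x⁻¹) * (1 - θ))]
      generalize q * (1 - x⁻¹) = c at *
      generalize (1 - c * (1 - θ)) ^ t = Λ at *
      generalize θ⁻¹ ^ (i + 1) = T at *
      generalize x ^ k = X at *
      have h6 := mul_le_mul_of_nonneg_left h3 (sub_nonneg.2 hc1)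
      have h7 := mul_le_mul_of_nonneg_left h4 hc0
      calc _ ≤ (1 - c) * (X * T * Λ) + c * (X * (θ * T) * Λ) := by nlinarith
        _ = _ := by ring

/-- Tail bound for the time at which the sink can decode. -/
theorem law_not_sinkDecodes_le (p : Fin L → I) (hL : 0 < L) {x θ q : ℝ} (hx : 1 < x) (hx2 : x ≤ 2)
    (hθ : 0 < θ) (hθ1 : θ ≤ 1) (hq : 0 ≤ q) (hq1 : q ≤ 1) (hqp : ∀ i, q ≤ p i) (n : ℕ) :
    law k p {ω | ¬ SinkDecodes hL ω n} ≤
      ENNReal.ofReal (x ^ k * (θ⁻¹) ^ L * (1 - q * (1 - x⁻¹) * (1 - θ)) ^ n / (x - 1)) := by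
  set E : Set (Outcome k L) := {ω | deficiency ω L le_rfl n ≠ 0} with hE
  have hEm : MeasurableSet E :=
    (measurable_deficiency L le_rfl n) (MeasurableSet.of_discrete (s := {d | d ≠ 0}))
  have hsub : {ω : Outcome k L | ¬ SinkDecodes hL ω n} ⊆ E := fun ω hω h0 =>
    hω (sinkDecodes_of_deficiency_eq_zero hL ω n h0)
  refine (measure_mono hsub).trans ?_
  -- Markov's inequality in the form `x ^ d ≥ 1 + (x - 1) * 1_{d ≠ 0}`; the constant `1` cancels
  -- against the one in `meanWeight_sub_one_le`.
  have h1 : 1 + ENNReal.ofReal (x - 1) * law k p E ≤ ∫⁻ ω, weight x ω L le_rfl n ∂law k p := by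
    have : 1 + ENNReal.ofReal (x - 1) * law k p E =
        ∫⁻ ω, 1 + ENNReal.ofReal (x - 1) * E.indicator 1 ω ∂law k p := by
      rw [lintegral_add_left measurable_const,
        lintegral_const_mul _ (measurable_one.indicator hEm), lintegral_indicator_one hEm]
      simp
    rw [this]
    refine lintegral_mono fun ω => ?_
    by_cases hω : ω ∈ E
    · simp only [Set.indicator_of_mem hω, Pi.one_apply, mul_one, weight]
      rw [← ENNReal.ofReal_one, ← ENNReal.ofReal_add zero_le_one (by linarith)]
      refine ENNReal.ofReal_le_ofReal ?_
      rw [add_sub_cancel]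
      exact le_self_pow₀ hx.le hω
    · have : deficiency ω L le_rfl n = 0 := by
        by_contra h
        exact hω h
      simp [hω, weight, this]
  have h2 := meanWeight_sub_one_le (k := k) p hx.le hx2 hθ hθ1 hq hq1 hqp n L le_rfl
  have h3 := ENNReal.toReal_mono (lintegral_weight_ne_top p hx.le L le_rfl n) h1
  rw [ENNReal.toReal_add (by finiteness) (by finiteness), ENNReal.toReal_mul,
    ENNReal.toReal_ofReal (by linarith), ENNReal.toReal_one] at h3
  rw [← ENNReal.ofReal_toReal (measure_ne_top (law k p) E)]
  refine ENNReal.ofReal_le_ofReal ?_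
  rw [le_div_iff₀ (by linarith)]
  unfold meanWeight at h2
  linarith

end

/-! ### Choice of parameters and the exponent -/

/-- With `τ = A / (8k)`, the starting weight costs `kτ` and the slots gain at least `(k + A - 1) τ
(1 - 2τ)`. The difference is at most `τ - Aτ/2`, since `2kτ² = Aτ/4` and `2Aτ² ≤ Aτ/4`. The factor
`θ⁻¹ ^ L / (x - 1)` gives the logarithm. -/
theorem tail_le_exp {k L n : ℕ} {A q : ℝ} (hA : 0 < A) (hAk : A ≤ k) (hq : 0 < q) (hq1 : q ≤ 1)
    (hn : (k + A) / q - 1 ≤ n) :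
    (1 + A / (8 * k)) ^ k * ((A / (8 * k))⁻¹) ^ L *
        (1 - q * (1 - (1 + A / (8 * k))⁻¹) * (1 - A / (8 * k))) ^ n / (1 + A / (8 * k) - 1) ≤
      Real.exp (1 + (L + 1) * Real.log (8 * k / A) - A ^ 2 / (16 * k)) := by
  have hk : (0 : ℝ) < k := hA.trans_le hAk
  have hinv : 8 * k / A = (A / (8 * k))⁻¹ := by rw [inv_div]
  have hτ : 0 < A / (8 * k) := by positivity
  have hτ1 : A / (8 * k) ≤ 1 / 8 := by
    rw [div_le_div_iff₀ (by positivity) (by norm_num)]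
    linarith
  have hAτ : A = 8 * k * (A / (8 * k)) := by field_simp
  have hsq : A ^ 2 / (16 * k) = A * (A / (8 * k)) / 2 := by
    field_simp
    ring
  rw [hinv, hsq]
  generalize A / (8 * k) = τ at *
  have h1 : (1 + τ) ^ k ≤ Real.exp (k * τ) := by
    rw [Real.exp_nat_mul]
    exact pow_le_pow_left₀ (by positivity) (by linarith [Real.add_one_le_exp τ]) k
  have hc : τ * (1 - τ) ≤ 1 - (1 + τ)⁻¹ := by
    have : 1 - (1 + τ)⁻¹ = τ / (1 + τ) := by
      field_simp
      ring
    rw [this, le_div_iff₀ (by positivity)]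
    nlinarith [pow_pos hτ 3]
  have hc1 : 1 - (1 + τ)⁻¹ ≤ 1 := by
    have : 0 < (1 + τ)⁻¹ := by positivity
    linarith
  have hc0 : 0 ≤ 1 - (1 + τ)⁻¹ := le_trans (by nlinarith) hc
  have hlow : q * (τ * (1 - 2 * τ)) ≤ q * (1 - (1 + τ)⁻¹) * (1 - τ) := by
    rw [mul_assoc]
    refine mul_le_mul_of_nonneg_left ?_ hq.le
    calc τ * (1 - 2 * τ) ≤ τ * (1 - τ) * (1 - τ) := by nlinarith [pow_pos hτ 3]
      _ ≤ _ := mul_le_mul_of_nonneg_right hc (by linarith)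
  have hup : q * (1 - (1 + τ)⁻¹) * (1 - τ) ≤ 1 :=
    mul_le_one₀ (mul_le_one₀ hq1 hc0 hc1) (by linarith) (by linarith)
  -- Rounding the time down loses less than one slot, hence at most `q ≤ 1` here.
  have hnq : k + A - 1 ≤ n * q := by
    have := mul_le_mul_of_nonneg_right hn hq.le
    rw [sub_mul, div_mul_cancel₀ _ hq.ne', one_mul] at this
    linarith
  have h2 : (1 - q * (1 - (1 + τ)⁻¹) * (1 - τ)) ^ n ≤
      Real.exp (-((k + A - 1) * (τ * (1 - 2 * τ)))) := by
    calc (1 - q * (1 - (1 + τ)⁻¹) * (1 - τ)) ^ n ≤ (Real.exp (-(q * (τ * (1 - 2 * τ))))) ^ n := by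
          refine pow_le_pow_left₀ (by linarith) ?_ n
          have := Real.add_one_le_exp (-(q * (τ * (1 - 2 * τ))))
          linarith
      _ = Real.exp (n * -(q * (τ * (1 - 2 * τ)))) := (Real.exp_nat_mul _ _).symm
      _ ≤ _ := by
          refine Real.exp_le_exp.2 ?_
          have : 0 ≤ τ * (1 - 2 * τ) := by nlinarith
          nlinarith
  have h3 : (τ⁻¹) ^ L / τ = Real.exp ((L + 1) * Real.log τ⁻¹) := by
    rw [div_eq_mul_inv, ← pow_succ, ← Real.rpow_natCast,
      Real.rpow_def_of_pos (inv_pos.2 hτ), mul_comm]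
    push_cast
    rfl
  calc (1 + τ) ^ k * (τ⁻¹) ^ L * (1 - q * (1 - (1 + τ)⁻¹) * (1 - τ)) ^ n / (1 + τ - 1)
      = (1 + τ) ^ k * (1 - q * (1 - (1 + τ)⁻¹) * (1 - τ)) ^ n * ((τ⁻¹) ^ L / τ) := by
        rw [add_sub_cancel_left]
        ring
    _ ≤ Real.exp (k * τ) * Real.exp (-((k + A - 1) * (τ * (1 - 2 * τ)))) *
        Real.exp ((L + 1) * Real.log τ⁻¹) := by
        rw [h3]
        refine mul_le_mul_of_nonneg_right ?_ (Real.exp_pos _).le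
        exact mul_le_mul h1 h2 (pow_nonneg (by linarith) n) (Real.exp_pos _).le
    _ ≤ _ := by
        rw [← Real.exp_add, ← Real.exp_add]
        refine Real.exp_le_exp.2 ?_
        nlinarith [mul_le_mul_of_nonneg_right hAk (sq_nonneg τ), sq_nonneg τ]

theorem log_le_logb_two {y : ℝ} (hy : 1 ≤ y) : Real.log y ≤ Real.logb 2 y := by
  rw [Real.logb, le_div_iff₀ (Real.log_pos one_lt_two)]
  have := Real.log_two_lt_d9
  nlinarith [Real.log_nonneg hy]

/-- Put `l = log (wL/ε)`. The term `kL/w` of the overhead serves to bound the logarithm by `2l`, and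
the square root gives `wl/16 ≥ 6Ll`. As `l ≥ 1`, the positive terms are at most `5Ll`, and the
remaining `Ll ≥ l` exceeds `-log ε`. -/
theorem overhead_exponent_le {k L w ε : ℝ} (hk : 0 < k) (hL : 1 ≤ L) (hw : 96 * L ≤ w)
    (hε : 0 < ε) (hε1 : ε < 1) :
    1 + (L + 1) * Real.log (8 * k / overhead k L w ε) - overhead k L w ε ^ 2 / (16 * k) ≤
      Real.log ε := by
  have hw0 : 96 ≤ w := by linarith
  have hy : w ≤ w * L / ε := by
    rw [le_div_iff₀ hε]
    nlinarith
  have hlw : 1 ≤ Real.log w := by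
    rw [Real.le_log_iff_exp_le (by linarith)]
    linarith [Real.exp_one_lt_d9]
  have hsplit : Real.log (w * L / ε) = Real.log w + Real.log L - Real.log ε := by
    rw [Real.log_div (by positivity) hε.ne', Real.log_mul (by positivity) (by positivity)]
  have hlL : 0 ≤ Real.log L := Real.log_nonneg hL
  have hlε : Real.log ε ≤ 0 := Real.log_nonpos hε.le hε1.le
  have hb : Real.log (w * L / ε) ≤ Real.logb 2 (w * L / ε) := log_le_logb_two (by linarith)
  set l := Real.log (w * L / ε) with hl
  have hb0 : 0 ≤ w * Real.logb 2 (w * L / ε) := mul_nonneg (by linarith) (by linarith)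
  have hfirst : k * L / w ≤ overhead k L w ε := by
    unfold overhead
    have := Real.sqrt_nonneg (k * (w * Real.logb 2 (w * L / ε)))
    linarith
  have hA : 0 < overhead k L w ε := lt_of_lt_of_le (by positivity) hfirst
  have hsq : k * (w * l) ≤ overhead k L w ε ^ 2 := by
    have h1 : √(k * (w * Real.logb 2 (w * L / ε))) ≤ overhead k L w ε := by
      unfold overhead
      have : 0 ≤ k * L / w := by positivity
      linarith
    have h2 := pow_le_pow_left₀ (Real.sqrt_nonneg _) h1 2
    rw [Real.sq_sqrt (mul_nonneg hk.le hb0)] at h2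
    refine le_trans ?_ h2
    gcongr
  have hlog : Real.log (8 * k / overhead k L w ε) ≤ 2 * l := by
    have h1 : 8 * k / overhead k L w ε ≤ w ^ 2 := by
      rw [div_le_iff₀ hA]
      refine le_trans ?_ (mul_le_mul_of_nonneg_left hfirst (by positivity))
      have : w ^ 2 * (k * L / w) = w * k * L := by
        field_simp
      rw [this]
      nlinarith [mul_pos hk (by linarith : 0 < w)]
    calc Real.log (8 * k / overhead k L w ε) ≤ Real.log (w ^ 2) :=
          Real.log_le_log (by positivity) h1
      _ = 2 * Real.log w := by
          rw [Real.log_pow]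
          norm_num
      _ ≤ 2 * l := by linarith
  have hquad : w * l / 16 ≤ overhead k L w ε ^ 2 / (16 * k) := by
    rw [div_le_div_iff₀ (by norm_num) (by positivity)]
    nlinarith
  have hl1 : 1 ≤ l := by linarith
  have hmul := mul_le_mul_of_nonneg_left hlog (by linarith : 0 ≤ L + 1)
  nlinarith [mul_le_mul_of_nonneg_right hw (by linarith : 0 ≤ l)]

theorem overhead_le {k L w ε : ℝ} (hk : 0 < k) (hL : 1 ≤ L) (hw : 96 * L ≤ w)
    (hwk : w * Real.logb 2 (w * L / ε) ≤ k / 16) : overhead k L w ε ≤ k := by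
  have hw0 : 0 < w := by linarith
  have h1 : k * L / w ≤ k / 96 := by
    rw [div_le_div_iff₀ hw0 (by norm_num)]
    nlinarith
  have h2 : √(k * (w * Real.logb 2 (w * L / ε))) ≤ k / 4 := by
    rw [Real.sqrt_le_left (by positivity)]
    nlinarith
  unfold overhead
  linarith

/-! ### Growth of the window parameter -/

theorem exists_forall_logb_le_sqrt :
    ∃ K : ℝ, 2 ≤ K ∧ ∀ y, K ≤ y → 8 * Real.logb 2 y ≤ √y := by
  have h := (isLittleO_log_rpow_atTop (r := 1 / 2) (by norm_num)).def
    (c := Real.log 2 / 8) (by have := Real.log_pos one_lt_two; positivity)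
  obtain ⟨K, hK⟩ := eventually_atTop.1 h
  refine ⟨max K 2, le_max_right _ _, fun y hy => ?_⟩
  have hy1 := hK y ((le_max_left _ _).trans hy)
  have hy2 : 2 ≤ y := (le_max_right _ _).trans hy
  rw [Real.norm_of_nonneg (Real.log_nonneg (by linarith)), Real.norm_of_nonneg (by positivity),
    ← Real.sqrt_eq_rpow] at hy1
  have hl := Real.log_pos one_lt_two
  rw [Real.logb, mul_div_assoc', div_le_iff₀ hl]
  linarith

/-- Put `Λ = log₂ (kL/ε)`. The cube hypothesis makes `log₂ (wL/ε)` at least `Λ/6`, so `wΛ` is small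
compared with `k`. Inserted in the cube hypothesis times `Λ²`, this makes `LΛ` small compared with
`k`, and then the cube hypothesis gives `w³ ≥ (96L)³`. -/
theorem mul_le_of_cube_le {k L w ε : ℝ} (hk : 2 ≤ k) (hL : 1 ≤ L) (hε : 0 < ε) (hε1 : ε < 1)
    (hw : 0 < w) (hlog : 8 * Real.logb 2 (k * L / ε) ≤ √(k * L / ε))
    (hcube : k * L ^ 2 ≤ 8 * Real.logb 2 (k * L / ε) * w ^ 3)
    (hwk : w * Real.logb 2 (w * L / ε) ≤ k / 442368) : 96 * L ≤ w := by
  set Y := k * L / ε with hY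
  set Λ := Real.logb 2 Y with hΛ
  have hkY : k ≤ Y := by
    rw [hY, le_div_iff₀ hε]
    nlinarith
  have hY0 : 0 < Y := by linarith
  have hΛ1 : 1 ≤ Λ := by
    rw [hΛ, Real.le_logb_iff_rpow_le one_lt_two hY0, Real.rpow_one]
    linarith
  have hpow : √Y ≤ (w * L / ε) ^ 3 := by
    have h1 : Y ≤ 8 * Λ * (w * L / ε) ^ 3 := by
      have h2 : Y ≤ k * L ^ 2 * (L ^ 3 / ε ^ 3) := by
        have e : k * L ^ 2 * (L ^ 3 / ε ^ 3) = Y * (L ^ 4 / ε ^ 2) := by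
          rw [hY]
          field_simp
        rw [e]
        have : 1 ≤ L ^ 4 / ε ^ 2 := by
          rw [le_div_iff₀ (by positivity), one_mul]
          exact (pow_le_one₀ hε.le hε1.le).trans (one_le_pow₀ hL)
        nlinarith
      refine h2.trans ?_
      have := mul_le_mul_of_nonneg_right hcube (by positivity : 0 ≤ L ^ 3 / ε ^ 3)
      refine this.trans (le_of_eq ?_)
      rw [div_pow, mul_pow]
      ring
    have h3 : √Y * √Y ≤ √Y * (w * L / ε) ^ 3 := by
      rw [Real.mul_self_sqrt hY0.le]
      exact h1.trans (mul_le_mul_of_nonneg_right hlog (by positivity))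
    exact le_of_mul_le_mul_left h3 (Real.sqrt_pos.2 hY0)
  have hlb : Λ / 6 ≤ Real.logb 2 (w * L / ε) := by
    have h1 := Real.logb_le_logb_of_le one_lt_two (Real.sqrt_pos.2 hY0) hpow
    rw [Real.logb_pow, Real.sqrt_eq_rpow, Real.logb_rpow_eq_mul_logb_of_pos hY0] at h1
    push_cast at h1
    linarith
  -- The constants are `442368 = 6 * 73728` and `73728 = 2 * 192²`, so that `8 * (k / 73728)³ = k *
  -- (k / 192³)²`; finally `192³ = 8 * 96³`.
  have h4 : w * Λ ≤ k / 73728 := by nlinarith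
  have h5 : (w * Λ) ^ 3 ≤ (k / 73728) ^ 3 := pow_le_pow_left₀ (by positivity) h4 3
  have h6 : (L * Λ) ^ 2 ≤ (k / 192 ^ 3) ^ 2 := by
    have h7 := mul_le_mul_of_nonneg_right hcube (by positivity : 0 ≤ Λ ^ 2)
    have h8 : k * (L * Λ) ^ 2 ≤ k * (k / 192 ^ 3) ^ 2 := by
      calc k * (L * Λ) ^ 2 = k * L ^ 2 * Λ ^ 2 := by ring
        _ ≤ 8 * Λ * w ^ 3 * Λ ^ 2 := h7
        _ = 8 * (w * Λ) ^ 3 := by ring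
        _ ≤ 8 * (k / 73728) ^ 3 := by linarith
        _ = k * (k / 192 ^ 3) ^ 2 := by ring
    exact le_of_mul_le_mul_left h8 (by linarith)
  have h9 : L * Λ ≤ k / 192 ^ 3 := le_of_sq_le_sq h6 (by positivity)
  have h10 : (96 * L) ^ 3 ≤ w ^ 3 := by
    have h11 : L * Λ * 192 ^ 3 ≤ k := by linarith
    have h12 : (8 * Λ) * (96 * L) ^ 3 ≤ (8 * Λ) * w ^ 3 := by
      calc (8 * Λ) * (96 * L) ^ 3 = L * Λ * 192 ^ 3 * L ^ 2 := by ring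
        _ ≤ k * L ^ 2 := mul_le_mul_of_nonneg_right h11 (by positivity)
        _ ≤ _ := hcube
    exact le_of_mul_le_mul_left h12 (by positivity)
  exact le_of_pow_le_pow_left₀ three_ne_zero hw.le h10

theorem eventually_window
    (L : ℕ → ℕ) (hL : ∀ k, 0 < L k) (ε : ℕ → ℝ) (hε : ∀ k, 0 < ε k ∧ ε k < 1) (w : ℕ → ℝ)
    (hw : w ~[atTop] fun k : ℕ =>
      ((k : ℝ) * (L k : ℝ) ^ 2 / Real.logb 2 ((k : ℝ) * (L k : ℝ) / ε k)) ^ (1 / 3 : ℝ))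
    (hwk : (fun k : ℕ => w k * Real.logb 2 (w k * (L k : ℝ) / ε k)) =o[atTop]
      fun k : ℕ => (k : ℝ)) :
    ∀ᶠ k : ℕ in atTop, 0 < (k : ℝ) ∧ 96 * (L k : ℝ) ≤ w k ∧
      w k * Real.logb 2 (w k * (L k : ℝ) / ε k) ≤ k / 16 := by
  obtain ⟨K, hK2, hK⟩ := exists_forall_logb_le_sqrt
  have h1 := hw.isLittleO.def (c := 1 / 2) (by norm_num)
  have h2 := hwk.def (c := 1 / 442368) (by norm_num)
  have h3 : ∀ᶠ k : ℕ in atTop, K ≤ (k : ℝ) := tendsto_natCast_atTop_atTop.eventually_ge_atTop K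
  filter_upwards [h1, h2, h3] with k h1 h2 h3
  have hk : (0 : ℝ) < k := by linarith
  have hL1 : (1 : ℝ) ≤ L k := by exact_mod_cast hL k
  obtain ⟨he, he1⟩ := hε k
  have hkY : (k : ℝ) ≤ k * L k / ε k := by
    rw [le_div_iff₀ he]
    nlinarith
  have hΛ : 0 < Real.logb 2 (k * L k / ε k) := Real.logb_pos one_lt_two (by linarith)
  have hwk' : w k * Real.logb 2 (w k * L k / ε k) ≤ k / 442368 := by
    rw [Real.norm_eq_abs, Real.norm_of_nonneg hk.le] at h2
    linarith [le_abs_self (w k * Real.logb 2 (w k * L k / ε k))]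
  set B : ℝ := (k : ℝ) * (L k : ℝ) ^ 2 / Real.logb 2 ((k : ℝ) * (L k : ℝ) / ε k) with hB
  have hB0 : 0 < B := by positivity
  have hR : 0 < B ^ (1 / 3 : ℝ) := Real.rpow_pos_of_pos hB0 _
  have hR3 : (B ^ (1 / 3 : ℝ)) ^ 3 = B := by
    rw [← Real.rpow_natCast, ← Real.rpow_mul hB0.le]
    norm_num
  -- Only this lower half of the equivalence is used; cubing it produces the factor `8` in `hcube`.
  have hwR : B ^ (1 / 3 : ℝ) / 2 ≤ w k := by
    rw [Pi.sub_apply, Real.norm_eq_abs, Real.norm_of_nonneg hR.le] at h1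
    linarith [(abs_le.1 h1).1]
  have hw0 : 0 < w k := by linarith
  have hcube : (k : ℝ) * (L k : ℝ) ^ 2 ≤ 8 * Real.logb 2 (k * L k / ε k) * w k ^ 3 := by
    have h5 := pow_le_pow_left₀ (by positivity) hwR 3
    rw [div_pow, hR3] at h5
    have h6 : B * Real.logb 2 (k * L k / ε k) = k * (L k : ℝ) ^ 2 := div_mul_cancel₀ _ hΛ.ne'
    rw [← h6]
    nlinarith
  exact ⟨hk, mul_le_of_cube_le (by linarith) hL1 he he1 hw0 (hK _ (h3.trans hkY)) hcube hwk',
    by linarith⟩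

/-! ### From decoding times to the coding delay -/

theorem codingDelay_le_of_sinkDecodes {k L : ℕ} (hL : 0 < L) (ω : Outcome k L) {n : ℕ}
    (h : SinkDecodes hL ω n) : codingDelay hL ω ≤ n :=
  iInf₂_le n h

theorem not_sinkDecodes_floor_of_lt {k L : ℕ} (hL : 0 < L) (ω : Outcome k L) {X : ℝ} (hX : 0 ≤ X)
    (h : (X : EReal) < ((codingDelay hL ω : ℝ≥0∞) : EReal)) : ¬ SinkDecodes hL ω ⌊X⌋₊ := by
  intro hd
  refine absurd h (not_lt.2 ?_)
  have h1 : ((codingDelay hL ω : ℝ≥0∞) : EReal) ≤ (((⌊X⌋₊ : ℕ) : ℝ≥0∞) : EReal) := by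
    refine EReal.coe_ennreal_le_coe_ennreal_iff.2 ?_
    exact_mod_cast codingDelay_le_of_sinkDecodes hL ω hd
  refine h1.trans ?_
  have h2 : (((⌊X⌋₊ : ℕ) : ℝ≥0∞) : EReal) = (((⌊X⌋₊ : ℕ) : ℝ) : EReal) := by
    rw [← ENNReal.coe_natCast, EReal.coe_nnreal_eq_coe_real, NNReal.coe_natCast]
  rw [h2]
  exact EReal.coe_le_coe_iff.2 (Nat.floor_le hX)

end LineNetwork

theorem mainTheorem1
    (L : ℕ → ℕ) (hL : ∀ k, 0 < L k)
    (ε : ℕ → ℝ) (hε : ∀ k, 0 < ε k ∧ ε k < 1)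
    (w : ℕ → ℝ)
    (hw : w ~[atTop] fun k : ℕ =>
      ((k : ℝ) * (L k : ℝ) ^ 2 / Real.logb 2 ((k : ℝ) * (L k : ℝ) / ε k)) ^ (1 / 3 : ℝ))
    (hwk : (fun k : ℕ => w k * Real.logb 2 (w k * (L k : ℝ) / ε k)) =o[atTop]
      fun k : ℕ => (k : ℝ)) :
    ∃ δ : ℕ → ℝ, Tendsto δ atTop (𝓝 0) ∧
      ∀ᶠ k : ℕ in atTop, ∀ p : Fin (L k) → unitInterval, (∀ i, 0 < p i) →
        LineNetwork.law k p
            {ω | (((1 / (⨅ i, (p i : ℝ))) *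
                  ((k : ℝ) + (1 + δ k) * LineNetwork.overhead k (L k) (w k) (ε k)) : ℝ) : EReal) <
                ((LineNetwork.codingDelay (hL k) ω : ℝ≥0∞) : EReal)}
          ≤ ENNReal.ofReal (ε k) := by
  -- The bound holds without any slack in the factor `1 + δ`, so `δ = 0` works.
  refine ⟨fun _ => 0, tendsto_const_nhds, ?_⟩
  filter_upwards [LineNetwork.eventually_window L hL ε hε w hw hwk] with k hk p hp
  obtain ⟨hk, hwL, hwk⟩ := hk
  have hL1 : (1 : ℝ) ≤ L k := by exact_mod_cast hL k
  have : Nonempty (Fin (L k)) := ⟨⟨0, hL k⟩⟩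
  obtain ⟨i₀, hi₀⟩ := exists_eq_ciInf_of_finite (f := fun i => (p i : ℝ))
  have hqp : ∀ i, (⨅ i, (p i : ℝ)) ≤ p i := fun i => ciInf_le (Set.finite_range _).bddBelow i
  have hq : 0 < ⨅ i, (p i : ℝ) := hi₀ ▸ hp i₀
  have hq1 : (⨅ i, (p i : ℝ)) ≤ 1 := hi₀ ▸ (p i₀).2.2
  generalize (⨅ i, (p i : ℝ)) = q at *
  have hexp := LineNetwork.overhead_exponent_le hk hL1 hwL (hε k).1 (hε k).2
  have hAk := LineNetwork.overhead_le hk hL1 hwL hwk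
  have hA : 0 < LineNetwork.overhead k (L k) (w k) (ε k) := by
    have hw0 : 0 < w k := by linarith
    have hy : 1 ≤ w k * L k / ε k := by
      rw [le_div_iff₀ (hε k).1]
      nlinarith [(hε k).2]
    have h1 : 0 < k * L k / w k := by positivity
    have h2 := Real.logb_nonneg one_lt_two hy
    unfold LineNetwork.overhead
    positivity
  generalize LineNetwork.overhead k (L k) (w k) (ε k) = A at *
  have hX : 1 / q * (k + (1 + 0) * A) = (k + A) / q := by ring
  rw [hX]
  have hX0 : 0 ≤ (k + A) / q := by positivity
  have hτ : 0 < A / (8 * k) := by positivity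
  have hτ1 : A / (8 * k) ≤ 1 := by
    rw [div_le_one (by positivity)]
    linarith
  calc _ ≤ LineNetwork.law k p {ω | ¬ LineNetwork.SinkDecodes (hL k) ω ⌊(k + A) / q⌋₊} :=
        measure_mono fun ω hω => LineNetwork.not_sinkDecodes_floor_of_lt (hL k) ω hX0 hω
    -- The same small number `A / (8k)` serves as `x - 1` and as `θ`; `A ≤ k` keeps `x ≤ 2` and `θ ≤
    -- 1`.
    _ ≤ _ := LineNetwork.law_not_sinkDecodes_le p (hL k) (x := 1 + A / (8 * k))
        (θ := A / (8 * k)) (by linarith) (by linarith) hτ hτ1 hq.le hq1 hqp _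
    _ ≤ ENNReal.ofReal (ε k) := by
        refine ENNReal.ofReal_le_ofReal ?_
        refine (LineNetwork.tail_le_exp hA hAk hq hq1 (Nat.sub_one_lt_floor _).le).trans ?_
        rw [← Real.le_log_iff_exp_le (hε k).1]
        exact hexp
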